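/- A quiver $Q$ is a finite directed graph, possibly with multiple arrows, without loops and directed $2$-cycles. The mutation of $Q$ at a vertex $v$ adds an arrow $u\to w$ for every pair of arrows $u\to v\to w$, reverses all arrows at $v$, and then removes directed $2$-cycles until none is left. Let $Q$ be a quiver with a bipartition $\epsilon:\mathrm{Vert}(Q)\to\{0,1\}$, i.e. $\epsilon_u\ne\epsilon_v$ for every arrow $u\to v$. Call $Q$ \emph{recurrent} if the combined mutation at all vertices with $\epsilon_v=0$, and also the combined mutation at all vertices with $\epsilon_v=1$, reverses all arrows of $Q$ and has no other effect. For $\lambda:\mathrm{Vert}(Q)\to\mathbb R$, the tropical $T$-system $\mathfrak t^\lambda$ is the family of reals $\mathfrak t^\lambda_v(t)$, for $v\in\mathrm{Vert}(Q)$ and $t\in\mathbb Z$ with $t+\epsilon_v$ even, such that $\mathfrak t^\lambda_v(\epsilon_v)=\lambda(v)$ and, for all $v$ and all $t\in\mathbb Z$ with $t+1+\epsilon_v$ even, $$\mathfrak t^\lambda_v(t+1)+\mathfrak t^\lambda_v(t-1)=\max\Big(\sum_{u\to v}\mathfrak t^\lambda_u(t),\ \sum_{v\to w}\mathfrak t^\lambda_w(t)\Big),$$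 the sums being over all arrows. A positive integer $N$ is called a half-period of $\mathfrak t^\lambda$ if $\mathfrak t^\lambda_v(t+2N)=\mathfrak t^\lambda_v(t)$ for all $v$, $t$ with $t+\epsilon_v$ even; $\mathfrak t^\lambda$ is periodic if it has a half-period. A strictly subadditive labeling of $Q$ is a map $\nu:\mathrm{Vert}(Q)\to\mathbb R_{>0}$ such that for every vertex $v$ $$2\nu(v)>\sum_{u\to v}\nu(u)\quad\text{and}\quad 2\nu(v)>\sum_{v\to w}\nu(w).$$ \textbf{Proposition.} Let $Q$ be a bipartite recurrent quiver such that the tropical $T$-system $\mathfrak t^\lambda$ is periodic for every $\lambda:\mathrm{Vert}(Q)\to\mathbb R$. Then $Q$ has a strictly subadditive labeling. Moreover, with $\delta_u(v)=1$ if $u=v$ and $\delta_u(v)=0$ otherwise, the systems $\mathfrak t^{\delta_u}$, $u\in\mathrm{Vert}(Q)$, have a common half-period; and if $Q$ has no isolated vertices, then for every common half-period $N$ of these systems $$\nu(v):=\sum_{u\in\mathrm{Vert}(Q)}\ \sum_{j=0}^{N-1}\mathfrak t^{\delta_u}_v(2j+\epsilon_v)$$ is a strictly subadditive labeling of $Q$.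 -/

import Mathlib

open Finset

/-- A quiver on the vertex set `V`: a directed graph, possibly with multiple arrows, without loops
and without directed `2`-cycles. `arrows u v` is the number of arrows `u → v`. -/
@[ext]
structure ClusterQuiver (V : Type*) where
  arrows : V → V → ℕ
  no_loop : ∀ v, arrows v v = 0
  no_two_cycle : ∀ u v, arrows u v = 0 ∨ arrows v u = 0

namespace ClusterQuiver

variable {V : Type*}

/-- The quiver with all arrows reversed. -/
def reverse (Q : ClusterQuiver V) : ClusterQuiver V where
  arrows u v := Q.arrows v u
  no_loop := Q.no_loop
  no_two_cycle u v := Q.no_two_cycle v u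

/-- Number of arrows `u → w` (for `u` and `w` different from `v`) after adding one arrow `u → w`
for each pair of arrows `u → v`, `v → w`, and before `2`-cycles are removed. -/
def arrowsWithPaths (Q : ClusterQuiver V) (v u w : V) : ℕ :=
  Q.arrows u w + Q.arrows u v * Q.arrows v w

/-- The quiver mutation at the vertex `v`: add an arrow `u → w` for each pair of arrows
`u → v → w`, reverse all arrows at `v`, and remove directed `2`-cycles one by one (the
subtraction below is truncated: it leaves the arrows that survive this cancellation). -/
def mutate [DecidableEq V] (Q : ClusterQuiver V) (v : V) : ClusterQuiver V where
  arrows u w :=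
    if u = v ∨ w = v then Q.arrows w u
    else Q.arrowsWithPaths v u w - Q.arrowsWithPaths v w u
  no_loop u := by
    split_ifs
    · exact Q.no_loop u
    · exact Nat.sub_self _
  no_two_cycle u w := by
    by_cases h : u = v ∨ w = v
    · simpa only [if_pos h, if_pos h.symm] using Q.no_two_cycle w u
    · have h' : ¬ (w = v ∨ u = v) := fun k => h k.symm
      simp only [if_neg h, if_neg h']
      omega

/-- Successive mutations at the vertices of a list, from left to right. -/
def mutateList [DecidableEq V] (Q : ClusterQuiver V) (l : List V) : ClusterQuiver V :=
  l.foldl mutate Q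

/-- A mutation at `a` only reverses the arrow between `a` and another vertex, and does not change
the arrows at a vertex `b` that is not joined to `a`. -/
theorem mutate_arrows_of_not_joined [DecidableEq V] (Q : ClusterQuiver V) {a b : V} (hne : b ≠ a)
    (hab : Q.arrows a b = 0) (hba : Q.arrows b a = 0) (u : V) :
    (Q.mutate a).arrows u b = Q.arrows u b ∧ (Q.mutate a).arrows b u = Q.arrows b u := by
  have h1 := Q.no_two_cycle u b
  by_cases hu : u = a
  · subst hu
    simp [mutate, hab, hba]
  · simp only [mutate, arrowsWithPaths, hab, hba, hu, hne, or_self, if_false, mul_zero, zero_mul,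
      add_zero]
    omega

/-- Mutations at two vertices that are not joined by an arrow commute. -/
theorem mutate_comm [DecidableEq V] (Q : ClusterQuiver V) {a b : V}
    (hab : Q.arrows a b = 0) (hba : Q.arrows b a = 0) :
    (Q.mutate a).mutate b = (Q.mutate b).mutate a := by
  by_cases hne : a = b
  · rw [hne]
  have hA := Q.mutate_arrows_of_not_joined (Ne.symm hne) hab hba
  have hB := Q.mutate_arrows_of_not_joined hne hba hab
  have key : ∀ (R : ClusterQuiver V) (x u w : V), (R.mutate x).arrows u w =
      if u = x ∨ w = x then R.arrows w u else
        R.arrows u w + R.arrows u x * R.arrows x w -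
          (R.arrows w u + R.arrows w x * R.arrows x u) := fun _ _ _ _ => rfl
  ext u w
  rw [key (Q.mutate a) b, key (Q.mutate b) a, (hA u).1, (hA u).2, (hA w).1, (hA w).2, (hB u).1,
    (hB u).2, (hB w).1, (hB w).2]
  by_cases hb : u = b ∨ w = b
  · have h1 : (Q.mutate a).arrows w u = Q.arrows w u := by
      rcases hb with h | h
      · rw [h]; exact (hA w).1
      · rw [h]; exact (hA u).2
    have h2 : (Q.mutate b).arrows w u = Q.arrows u w := by rw [key, if_pos hb.symm]
    have h3 : (Q.mutate b).arrows u w = Q.arrows w u := by rw [key, if_pos hb]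
    rw [if_pos hb, h1, h2, h3]
    by_cases ha : u = a ∨ w = a
    · rw [if_pos ha]
      rcases hb with rfl | rfl <;> rcases ha with h | h
      · exact absurd h.symm hne
      · subst h; rw [hab, hba]
      · subst h; rw [hab, hba]
      · exact absurd h.symm hne
    · rw [if_neg ha]
      have := Q.no_two_cycle u w
      rcases hb with rfl | rfl <;> simp only [hab, hba, mul_zero, zero_mul, add_zero] <;> omega
  · rw [if_neg hb]
    by_cases ha : u = a ∨ w = a
    · rw [if_pos ha, key, key, if_pos ha, if_pos ha.symm, key, if_neg (fun h => hb h.symm)]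
      rcases ha with rfl | rfl <;> simp only [hab, hba, mul_zero, zero_mul, add_zero]
    · have ha' : ¬ (w = a ∨ u = a) := fun h => ha h.symm
      have hb' : ¬ (w = b ∨ u = b) := fun h => hb h.symm
      rw [if_neg ha, key, key, key, key, if_neg ha, if_neg ha', if_neg hb, if_neg hb']
      omega

/-- A strictly subadditive labeling of the vertices by positive real numbers; the sums are over
all arrows `u → v`, respectively `v → w`, with multiplicity. -/
def IsStrictlySubadditiveLabeling [Fintype V] (Q : ClusterQuiver V) (ν : V → ℝ) : Prop :=
  (∀ v, 0 < ν v) ∧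
    ∀ v, ∑ u, (Q.arrows u v : ℝ) * ν u < 2 * ν v ∧ ∑ w, (Q.arrows v w : ℝ) * ν w < 2 * ν v

/-- The strictly subadditive labeling property. -/
def HasStrictlySubadditiveLabeling [Fintype V] (Q : ClusterQuiver V) : Prop :=
  ∃ ν : V → ℝ, Q.IsStrictlySubadditiveLabeling ν

/-- `max (∑_{u → v} s u) (∑_{v → w} s w)`, the sums being over all arrows. -/
noncomputable def tropicalRHS [Fintype V] (Q : ClusterQuiver V) (s : V → ℝ) (v : V) : ℝ :=
  max (∑ u, (Q.arrows u v : ℝ) * s u) (∑ w, (Q.arrows v w : ℝ) * s w)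

theorem tropicalRHS_congr [Fintype V] (Q : ClusterQuiver V) {s s' : V → ℝ} {v : V}
    (h : ∀ u, 0 < Q.arrows u v ∨ 0 < Q.arrows v u → s u = s' u) :
    Q.tropicalRHS s v = Q.tropicalRHS s' v := by
  unfold tropicalRHS
  congr 1 <;> refine Finset.sum_congr rfl fun u _ => ?_
  · rcases Nat.eq_zero_or_pos (Q.arrows u v) with h0 | h0
    · simp [h0]
    · rw [h u (Or.inl h0)]
  · rcases Nat.eq_zero_or_pos (Q.arrows v u) with h0 | h0
    · simp [h0]
    · rw [h u (Or.inr h0)]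

end ClusterQuiver

/-- A quiver together with a bipartition `color` of its vertices: `0` is white, `1` is black, and
every arrow joins two vertices of different colors. -/
structure BipartiteQuiver (V : Type*) extends ClusterQuiver V where
  color : V → Fin 2
  color_ne : ∀ u v, 0 < arrows u v → color u ≠ color v

namespace BipartiteQuiver

variable {V : Type*}

/-- The combined mutation at all vertices of color `c`. Vertices of the same color are not joined
by arrows, so the order in which the mutations are performed does not matter. -/
noncomputable def mutateColor [Fintype V] [DecidableEq V] (Q : BipartiteQuiver V) (c : Fin 2) :
    ClusterQuiver V :=
  Q.toClusterQuiver.mutateList (univ.filter fun v => Q.color v = c).toList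

/-- A bipartite quiver is recurrent if the combined mutation at all white vertices, and also the
one at all black vertices, reverses all arrows and has no other effect. -/
def IsRecurrent [Fintype V] [DecidableEq V] (Q : BipartiteQuiver V) : Prop :=
  ∀ c, Q.mutateColor c = Q.toClusterQuiver.reverse

/-- The color as an integer, `0` or `1`. -/
def eps (Q : BipartiteQuiver V) (v : V) : ℤ := ((Q.color v).val : ℤ)

theorem color_ne' (Q : BipartiteQuiver V) {u v : V}
    (h : 0 < Q.arrows u v ∨ 0 < Q.arrows v u) : Q.color u ≠ Q.color v :=
  h.elim (Q.color_ne u v) fun h => (Q.color_ne v u h).symm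

/-- One tropical update at all vertices of color `c`: the new value `s' v` at such a vertex is
given by `s' v + s v = max (∑_{u → v} s u) (∑_{v → w} s w)`. -/
noncomputable def tropicalUpdate [Fintype V] (Q : BipartiteQuiver V) (c : Fin 2) (s : V → ℝ) :
    V → ℝ :=
  fun v => if Q.color v = c then Q.tropicalRHS s v - s v else s v

theorem tropicalUpdate_involutive [Fintype V] (Q : BipartiteQuiver V) (c : Fin 2) :
    Function.Involutive (Q.tropicalUpdate c) := by
  intro s
  funext v
  by_cases h : Q.color v = c
  · have h' : Q.tropicalRHS (Q.tropicalUpdate c s) v = Q.tropicalRHS s v := by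
      refine Q.tropicalRHS_congr fun u hu => ?_
      have := Q.color_ne' hu
      rw [h] at this
      simp [tropicalUpdate, this]
    rw [tropicalUpdate, if_pos h, h', tropicalUpdate, if_pos h]
    ring
  · simp [tropicalUpdate, h]

/-- The values `v ↦ 𝔱_v (2 n + ε_v)` of the tropical `T`-system with initial values `l`: the white
values are updated first, then the black ones, and the inverse is used for negative `n`. -/
noncomputable def tropicalState [Fintype V] (Q : BipartiteQuiver V) (l : V → ℝ) (n : ℤ) : V → ℝ :=
  (((Q.tropicalUpdate_involutive 1).toPerm * (Q.tropicalUpdate_involutive 0).toPerm) ^ n :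
    Equiv.Perm (V → ℝ)) l

/-- The tropical `T`-system `𝔱^l_v (t)` with initial values `l`. It is meant only for `t + ε_v`
even; the other values play no role. -/
noncomputable def tropicalT [Fintype V] (Q : BipartiteQuiver V) (l : V → ℝ) (v : V) (t : ℤ) : ℝ :=
  Q.tropicalState l ((t - Q.eps v) / 2) v

/-- The initial conditions and the defining relations of the tropical `T`-system, restricted to the
pairs `(t, v)` with `t + ε_v` even. -/
def IsTropicalTSystem [Fintype V] (Q : BipartiteQuiver V) (l : V → ℝ) (T : V → ℤ → ℝ) : Prop :=
  (∀ v, T v (Q.eps v) = l v) ∧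
    ∀ v (t : ℤ), Even (t + 1 + Q.eps v) →
      T v (t + 1) + T v (t - 1) =
        max (∑ u, (Q.arrows u v : ℝ) * T u t) (∑ w, (Q.arrows v w : ℝ) * T w t)

theorem tropicalState_succ [Fintype V] (Q : BipartiteQuiver V) (l : V → ℝ) (n : ℤ) :
    Q.tropicalState l (n + 1) = Q.tropicalUpdate 1 (Q.tropicalUpdate 0 (Q.tropicalState l n)) := by
  rw [tropicalState, add_comm, zpow_add, zpow_one]
  rfl

theorem fin_two_cases (c : Fin 2) : c = 0 ∨ c = 1 := by omega

theorem tropicalT_of_eq [Fintype V] (Q : BipartiteQuiver V) (l : V → ℝ) (v : V) (t n : ℤ)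
    (h : t = 2 * n + Q.eps v) : Q.tropicalT l v t = Q.tropicalState l n v := by
  have : (t - Q.eps v) / 2 = n := by omega
  rw [tropicalT, this]

/-- `tropicalT` is a tropical `T`-system. -/
theorem isTropicalTSystem_tropicalT [Fintype V] (Q : BipartiteQuiver V) (l : V → ℝ) :
    Q.IsTropicalTSystem l (Q.tropicalT l) := by
  constructor
  · intro v
    rw [Q.tropicalT_of_eq l v _ 0 (by ring)]
    simp [tropicalState]
  · intro v t ht
    change _ = Q.tropicalRHS (fun u => Q.tropicalT l u t) v
    rcases fin_two_cases (Q.color v) with hv | hv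
    · have hev : Q.eps v = 0 := by simp [eps, hv]
      obtain ⟨n, hn⟩ : ∃ n, t = 2 * n + 1 := by
        obtain ⟨k, hk⟩ := ht
        exact ⟨k - 1, by omega⟩
      rw [Q.tropicalT_of_eq l v (t + 1) (n + 1) (by omega),
        Q.tropicalT_of_eq l v (t - 1) n (by omega), tropicalState_succ]
      have h : Q.tropicalRHS (fun u => Q.tropicalT l u t) v =
          Q.tropicalRHS (Q.tropicalState l n) v := by
        refine Q.tropicalRHS_congr fun u hu => ?_
        have hu' : Q.color u = 1 := by
          have := Q.color_ne' hu
          rcases fin_two_cases (Q.color u) with h | h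
          · exact absurd (h.trans hv.symm) this
          · exact h
        exact Q.tropicalT_of_eq l u t n (by simp [eps, hu', hn])
      rw [h]
      simp [tropicalUpdate, hv]
    · have hev : Q.eps v = 1 := by simp [eps, hv]
      obtain ⟨n, hn⟩ : ∃ n, t = 2 * (n + 1) := by
        obtain ⟨k, hk⟩ := ht
        exact ⟨k - 2, by omega⟩
      rw [Q.tropicalT_of_eq l v (t + 1) (n + 1) (by omega),
        Q.tropicalT_of_eq l v (t - 1) n (by omega)]
      have h : Q.tropicalRHS (fun u => Q.tropicalT l u t) v =
          Q.tropicalRHS (Q.tropicalUpdate 0 (Q.tropicalState l n)) v := by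
        refine Q.tropicalRHS_congr fun u hu => ?_
        have hu' : Q.color u = 0 := by
          have := Q.color_ne' hu
          rcases fin_two_cases (Q.color u) with h | h
          · exact h
          · exact absurd (h.trans hv.symm) this
        rw [Q.tropicalT_of_eq l u t (n + 1) (by simp [eps, hu', hn]), tropicalState_succ,
          tropicalUpdate, if_neg (by simp [hu'])]
      rw [h, tropicalState_succ, tropicalUpdate, if_pos hv]
      simp [tropicalUpdate, hv]

/-- The tropical `T`-system is determined by its initial values. -/
theorem IsTropicalTSystem.eq_of_even [Fintype V] {Q : BipartiteQuiver V} {l : V → ℝ}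
    {T T' : V → ℤ → ℝ} (h : Q.IsTropicalTSystem l T) (h' : Q.IsTropicalTSystem l T') (v : V)
    (t : ℤ) (ht : Even (t + Q.eps v)) : T v t = T' v t := by
  have e01 : ∀ v, Q.eps v = 0 ∨ Q.eps v = 1 := fun v => by
    rcases fin_two_cases (Q.color v) with h | h <;> simp [eps, h]
  have nb : ∀ (v u : V), 0 < Q.arrows u v ∨ 0 < Q.arrows v u → Q.eps u = 1 - Q.eps v := by
    intro v u hu
    have := Q.color_ne' hu
    rcases fin_two_cases (Q.color u) with h | h <;> rcases fin_two_cases (Q.color v) with h' | h' <;>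
      simp_all [eps]
  have key : ∀ n : ℤ, (∀ v, T v (n + ((n + Q.eps v) % 2)) = T' v (n + ((n + Q.eps v) % 2))) := by
    have step : ∀ (m : ℤ) (v : V), (m + 1 + Q.eps v) % 2 = 0 →
        (∀ u, Q.eps u = 1 - Q.eps v → T u m = T' u m) →
        T v (m + 1) + T v (m - 1) = T' v (m + 1) + T' v (m - 1) := by
      intro m v hm hu
      rw [h.2 v m (Int.even_iff.2 hm), h'.2 v m (Int.even_iff.2 hm)]
      exact Q.tropicalRHS_congr (s := fun u => T u m) (s' := fun u => T' u m)
        fun u hu' => hu u (nb v u hu')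
    intro n
    induction n using Int.induction_on with
    | zero =>
      intro v
      have : (0 : ℤ) + (0 + Q.eps v) % 2 = Q.eps v := by have := e01 v; omega
      rw [this, h.1, h'.1]
    | succ n ih =>
      intro v
      rcases Int.emod_two_eq_zero_or_one ((n : ℤ) + Q.eps v) with hv | hv
      · have hs := step (n + 1) v (by omega) fun u hu => by
          have := ih u
          rwa [show ((n : ℤ) + Q.eps u) % 2 = 1 by omega] at this
        have := ih v
        rw [hv] at this
        rw [show ((n : ℤ) + 1 + Q.eps v) % 2 = 1 by omega]
        simp only [add_sub_cancel_right, add_zero] at hs this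
        linarith
      · have := ih v
        rw [hv] at this
        rwa [show ((n : ℤ) + 1 + Q.eps v) % 2 = 0 by omega, add_zero]
    | pred n ih =>
      intro v
      rcases Int.emod_two_eq_zero_or_one (-(n : ℤ) + Q.eps v) with hv | hv
      · have := ih v
        rw [hv] at this
        rw [show (-(n : ℤ) - 1 + Q.eps v) % 2 = 1 by omega]
        simpa using this
      · have hs := step (-n) v (by omega) fun u hu => by
          have := ih u
          rwa [show (-(n : ℤ) + Q.eps u) % 2 = 0 by have := e01 v; omega, add_zero] at this
        have := ih v
        rw [hv] at this
        rw [show (-(n : ℤ) - 1 + Q.eps v) % 2 = 0 by omega, add_zero]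
        linarith
  have := key t v
  rwa [Int.even_iff.1 ht, add_zero] at this

/-- `2 N` is a period of the tropical `T`-system with initial values `l`. -/
def IsTropicalPeriod [Fintype V] (Q : BipartiteQuiver V) (l : V → ℝ) (N : ℕ) : Prop :=
  ∀ v (t : ℤ), Even (t + Q.eps v) → Q.tropicalT l v (t + 2 * N) = Q.tropicalT l v t

/-- The tropical `T`-system associated with `Q` is periodic, for any initial values. -/
def IsTropicallyPeriodic [Fintype V] (Q : BipartiteQuiver V) : Prop :=
  ∀ l : V → ℝ, ∃ N : ℕ, 0 < N ∧ Q.IsTropicalPeriod l N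

/-- The labeling `v ↦ ∑_u ∑_{j = 0}^{N - 1} 𝔱^{δ_u}_v (2 j + ε_v)`. -/
noncomputable def tropicalSum [Fintype V] [DecidableEq V] (Q : BipartiteQuiver V) (N : ℕ) (v : V) :
    ℝ :=
  ∑ u, ∑ j ∈ range N, Q.tropicalT (Pi.single u 1) v (2 * (j : ℤ) + Q.eps v)

end BipartiteQuiver

/-! Summing the defining relation over a period shows that twice the period sum at `v` equals a sum
of maxima, hence is at least either of the two neighbor sums of the period sums. Positivity and
strictness remain to be shown.

For positivity, keep only the arrows from white to black. This gives a symmetric nonnegative matrix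
`M` with `M s ≤ max(...)` at every vertex. A nonnegative eigenvector of `M` with eigenvalue at least
`2`, used both as weights and as initial values on the black vertices, would make a pairing grow
forever, against periodicity (`IsTropicallyPeriodic.eigenvector_eq_zero`). So, by Perron–Frobenius,
`M f ≤ 2 f` forces `f ≥ 0` (`nonneg_of_mulVec_le`), and this applies to the period sums.

For strictness it is enough that, for one `δ_p` and one time, the maximum exceeds the given neighbor
sum; `exists_sum_lt_sum` finds them at each vertex that is not isolated. There the strict inequality
turns nonnegativity into positivity. -/

/-! ### Perron–Frobenius for symmetric nonnegative matrices -/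

/-- A symmetric entrywise nonnegative matrix whose Rayleigh quotient reaches the value `2` has a
nonnegative eigenvector with an eigenvalue at least `2`. -/
theorem exists_nonneg_eigenvector {V : Type*} [Fintype V] {M : Matrix V V ℝ}
    (hM : M.IsSymm) (h0 : ∀ v u, 0 ≤ M v u) {g : V → ℝ} (hg : g ≠ 0)
    (hgM : 2 * (g ⬝ᵥ g) ≤ g ⬝ᵥ M.mulVec g) :
    ∃ (w : V → ℝ) (r : ℝ), 2 ≤ r ∧ (∀ v, 0 ≤ w v) ∧ w ≠ 0 ∧ M.mulVec w = r • w := by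
  classical
  have hpos : ∀ x : V → ℝ, x ≠ 0 → 0 < x ⬝ᵥ x := fun x hx =>
    lt_of_le_of_ne (Finset.sum_nonneg fun i _ => mul_self_nonneg (x i))
      (fun h => hx (dotProduct_self_eq_zero.1 h.symm))
  set q : (V → ℝ) → ℝ := fun x => x ⬝ᵥ M.mulVec x with hq
  have hqs : ∀ (c : ℝ) (x : V → ℝ), q (c • x) = c ^ 2 * q x := by
    intro c x
    simp only [hq, Matrix.mulVec_smul, smul_dotProduct, dotProduct_smul, smul_eq_mul]
    ring
  have hnorm : ∀ x : V → ℝ, x ≠ 0 → ((√(x ⬝ᵥ x))⁻¹ • x) ⬝ᵥ ((√(x ⬝ᵥ x))⁻¹ • x) = 1 := by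
    intro x hx
    have h := hpos x hx
    have h2 := Real.sq_sqrt h.le
    have h3 := Real.sqrt_pos.2 h
    rw [smul_dotProduct, dotProduct_smul, smul_eq_mul, smul_eq_mul]
    nth_rewrite 3 [← h2]
    field_simp
  have hK : IsCompact {x : V → ℝ | x ⬝ᵥ x = 1} := by
    refine Metric.isCompact_of_isClosed_isBounded ?_ ?_
    · refine isClosed_eq ?_ continuous_const
      unfold dotProduct
      fun_prop
    · refine (Metric.isBounded_closedBall (x := (0 : V → ℝ)) (r := 1)).subset fun x hx => ?_
      rw [mem_closedBall_zero_iff, pi_norm_le_iff_of_nonneg zero_le_one]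
      intro i
      rw [Real.norm_eq_abs, ← sq_le_one_iff_abs_le_one, sq]
      calc x i * x i ≤ ∑ j, x j * x j :=
            Finset.single_le_sum (f := fun j => x j * x j) (fun j _ => mul_self_nonneg (x j))
              (Finset.mem_univ i)
        _ = 1 := hx
  have hqc : Continuous q := by
    simp only [hq, dotProduct, Matrix.mulVec]
    fun_prop
  obtain ⟨y, hy, hmax⟩ := hK.exists_isMaxOn ⟨_, hnorm g hg⟩ hqc.continuousOn
  have hy : y ⬝ᵥ y = 1 := hy
  have hle : ∀ x : V → ℝ, q x ≤ q y * (x ⬝ᵥ x) := by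
    intro x
    by_cases hx : x = 0
    · simp [hx, hq]
    · have h1 : q ((√(x ⬝ᵥ x))⁻¹ • x) ≤ q y := hmax (hnorm x hx)
      rw [hqs, inv_pow, Real.sq_sqrt (hpos x hx).le, inv_mul_le_iff₀ (hpos x hx)] at h1
      linarith
  -- Since the entries of `M` are nonnegative, absolute values keep the norm and do not lower the
  -- quadratic form, so `w` is again a maximizer.
  set w : V → ℝ := fun v => |y v| with hw
  have hww : w ⬝ᵥ w = 1 := by
    rw [← hy]
    simp [dotProduct, hw]
  have hqw : q w = q y := by
    refine le_antisymm ((hle w).trans_eq (by rw [hww, mul_one])) ?_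
    simp only [hq, dotProduct, Matrix.mulVec, Finset.mul_sum]
    refine Finset.sum_le_sum fun v _ => Finset.sum_le_sum fun u _ => ?_
    calc y v * (M v u * y u) ≤ |y v * (M v u * y u)| := le_abs_self _
      _ = w v * (M v u * w u) := by rw [abs_mul, abs_mul, abs_of_nonneg (h0 v u)]
  have hmv : ∀ x : V → ℝ, (q y • (1 : Matrix V V ℝ) - M).mulVec x = q y • x - M.mulVec x := by
    intro x
    rw [Matrix.sub_mulVec, Matrix.smul_mulVec, Matrix.one_mulVec]
  -- Maximality makes this form positive semidefinite; it vanishes at `w`, so `w` lies in the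
  -- kernel, which is the eigenvalue equation.
  have hps : (q y • (1 : Matrix V V ℝ) - M).PosSemidef := by
    refine Matrix.PosSemidef.of_dotProduct_mulVec_nonneg ?_ fun x => ?_
    · rw [Matrix.IsHermitian, Matrix.conjTranspose_eq_transpose_of_trivial, Matrix.transpose_sub,
        Matrix.transpose_smul, Matrix.transpose_one, hM]
    · rw [star_trivial, hmv, dotProduct_sub, dotProduct_smul, smul_eq_mul]
      exact sub_nonneg.2 (hle x)
  have hz : (q y • (1 : Matrix V V ℝ) - M).mulVec w = 0 := by
    rw [← hps.dotProduct_mulVec_zero_iff, star_trivial, hmv, dotProduct_sub, dotProduct_smul,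
      smul_eq_mul, hww, mul_one, ← hqw]
    exact sub_self _
  refine ⟨w, q y, ?_, fun v => abs_nonneg _, ?_, ?_⟩
  · have := hgM.trans (hle g)
    exact le_of_mul_le_mul_right this (hpos g hg)
  · rintro h
    simp [h] at hww
  · rw [hmv] at hz
    exact (sub_eq_zero.1 hz).symm

/-- If a symmetric nonnegative matrix has no nonnegative eigenvector with an eigenvalue at least
`2`, then `M f ≤ 2 f` implies `0 ≤ f`. -/
theorem nonneg_of_mulVec_le {V : Type*} [Fintype V] {M : Matrix V V ℝ}
    (hM : M.IsSymm) (h0 : ∀ v u, 0 ≤ M v u)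
    (hno : ∀ (w : V → ℝ) (r : ℝ), 2 ≤ r → (∀ v, 0 ≤ w v) → M.mulVec w = r • w → w = 0)
    {f : V → ℝ} (hf : ∀ v, M.mulVec f v ≤ 2 * f v) (v : V) : 0 ≤ f v := by
  by_contra! hv
  -- The negative part of `f` satisfies `M g ≥ 2 g`, hence has Rayleigh quotient at least `2`.
  set g : V → ℝ := fun v => max (-f v) 0 with hg
  have hg0 : ∀ v, 0 ≤ g v := fun v => le_max_right _ _
  have hne : g ≠ 0 := fun h => by
    have h1 : -f v ≤ g v := le_max_left _ _
    rw [h, Pi.zero_apply] at h1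
    linarith
  have hge : ∀ v, 2 * g v ≤ M.mulVec g v := by
    intro v
    have hnn : 0 ≤ M.mulVec g v := Finset.sum_nonneg fun u _ => mul_nonneg (h0 v u) (hg0 u)
    rcases le_total 0 (f v) with h | h
    · have : g v = 0 := max_eq_right (by linarith)
      rw [this]
      linarith
    · have h1 : g v = -f v := max_eq_left (by linarith)
      have h2 : -M.mulVec f v ≤ M.mulVec g v := by
        simp only [Matrix.mulVec, dotProduct, ← Finset.sum_neg_distrib, ← mul_neg]
        exact Finset.sum_le_sum fun u _ => mul_le_mul_of_nonneg_left (le_max_left _ _) (h0 v u)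
      have := hf v
      rw [h1]
      linarith
  obtain ⟨w, r, hr, hw, hw0, he⟩ := exists_nonneg_eigenvector hM h0 hne (by
    rw [dotProduct, Finset.mul_sum]
    refine Finset.sum_le_sum fun u _ => ?_
    have := mul_le_mul_of_nonneg_left (hge u) (hg0 u)
    linarith)
  exact hw0 (hno w r hr hw he)

/-! ### Sums of periodic sequences over a period -/

/-- The sums of a periodic sequence over a period and over a shifted period agree. -/
theorem sum_range_add_of_periodic {g : ℤ → ℝ} {N : ℕ} (hg : ∀ j, g (j + N) = g j) :
    ∑ j ∈ range N, g ((j : ℤ) + 1) = ∑ j ∈ range N, g j := by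
  have h1 := Finset.sum_range_succ (fun j : ℕ => g j) N
  have h2 := Finset.sum_range_succ' (fun j : ℕ => g j) N
  have h3 := hg 0
  push_cast at h1 h2
  rw [zero_add] at h3
  linarith

/-- A nonnegative periodic sequence that is positive somewhere has a positive sum over a period. -/
theorem sum_range_pos_of_periodic {g : ℤ → ℝ} {N : ℕ} (hN : 0 < N) (hg : ∀ j, g (j + N) = g j)
    (h0 : ∀ j, 0 ≤ g j) {i : ℤ} (hi : 0 < g i) : 0 < ∑ j ∈ range N, g j := by
  have hN' : (0 : ℤ) < N := by exact_mod_cast hN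
  have hp : Function.Periodic g (N : ℤ) := hg
  obtain ⟨k, hk⟩ := Int.eq_ofNat_of_zero_le (Int.emod_nonneg i hN'.ne')
  refine Finset.sum_pos' (fun j _ => h0 j) ⟨k, ?_, ?_⟩
  · have := Int.emod_lt_of_pos i hN'
    rw [Finset.mem_range]
    omega
  · rw [← hk, Int.emod_def, mul_comm]
    have := hp.sub_zsmul_eq (i / N) (x := i)
    rw [smul_eq_mul] at this
    rwa [this]

/-! ### The white-to-black matrix and the relations between states -/

namespace BipartiteQuiver

section

variable {V : Type*} (Q : BipartiteQuiver V)

theorem eps_add_eps_of_ne {u v : V} (h : Q.color u ≠ Q.color v) : Q.eps u + Q.eps v = 1 := by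
  rcases fin_two_cases (Q.color u) with hu | hu <;> rcases fin_two_cases (Q.color v) with hv | hv <;>
    simp_all [eps]

/-- The symmetric adjacency matrix of the arrows from white to black vertices. -/
def whiteToBlack : Matrix V V ℝ :=
  fun v u => if Q.color v = 0 then (Q.arrows v u : ℝ) else Q.arrows u v

theorem whiteToBlack_nonneg (v u : V) : 0 ≤ Q.whiteToBlack v u := by
  unfold whiteToBlack
  split_ifs <;> positivity

theorem whiteToBlack_eq_zero {v u : V} (h : Q.color v = Q.color u) : Q.whiteToBlack v u = 0 := by
  have h1 : Q.arrows v u = 0 := by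
    by_contra h1
    exact Q.color_ne v u (Nat.pos_of_ne_zero h1) h
  have h2 : Q.arrows u v = 0 := by
    by_contra h2
    exact Q.color_ne u v (Nat.pos_of_ne_zero h2) h.symm
  simp [whiteToBlack, h1, h2]

theorem whiteToBlack_isSymm : Q.whiteToBlack.IsSymm := by
  ext v u
  rw [Matrix.transpose_apply]
  by_cases h : Q.color v = Q.color u
  · rw [Q.whiteToBlack_eq_zero h, Q.whiteToBlack_eq_zero h.symm]
  · rcases fin_two_cases (Q.color u) with hu | hu <;>
      rcases fin_two_cases (Q.color v) with hv | hv <;> simp_all [whiteToBlack]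

variable [Fintype V]

theorem tropicalState_zero (l : V → ℝ) : Q.tropicalState l 0 = l := by
  simp [tropicalState]

/-- The defining relations of the tropical `T`-system in terms of the states. -/
theorem tropicalState_add (l : V → ℝ) (j : ℤ) (v : V) :
    Q.tropicalState l (j + 1) v + Q.tropicalState l j v =
      Q.tropicalRHS (Q.tropicalState l (j + Q.eps v)) v := by
  -- The time halfway between the two values at `v`. A neighbor `u` has `ε_u = 1 - ε_v`, so there
  -- its state index is `j + ε_v`.
  have h := (Q.isTropicalTSystem_tropicalT l).2 v (2 * j + 1 + Q.eps v) ⟨j + 1 + Q.eps v, by ring⟩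
  rw [Q.tropicalT_of_eq l v _ (j + 1) (by ring), Q.tropicalT_of_eq l v _ j (by ring)] at h
  refine h.trans (Q.tropicalRHS_congr (s := fun u => Q.tropicalT l u (2 * j + 1 + Q.eps v))
    fun u hu => ?_)
  have := Q.eps_add_eps_of_ne (Q.color_ne' hu)
  exact Q.tropicalT_of_eq l u _ _ (by linarith)

theorem tropicalState_add_period {l : V → ℝ} {N : ℕ} (h : Q.IsTropicalPeriod l N) (j : ℤ) :
    Q.tropicalState l (j + N) = Q.tropicalState l j := by
  funext v
  have := h v (2 * j + Q.eps v) ⟨j + Q.eps v, by ring⟩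
  rwa [Q.tropicalT_of_eq l v _ (j + N) (by ring), Q.tropicalT_of_eq l v _ j rfl] at this

theorem IsTropicalPeriod.mul {Q : BipartiteQuiver V} {l : V → ℝ} {N : ℕ}
    (h : Q.IsTropicalPeriod l N) (k : ℕ) : Q.IsTropicalPeriod l (N * k) := by
  intro v t ht
  induction k with
  | zero => simp
  | succ k ih =>
    rw [← ih, ← h v (t + 2 * (N * k : ℕ))]
    · congr 1
      push_cast
      ring
    · obtain ⟨a, ha⟩ := ht
      exact ⟨a + (N * k : ℕ), by rw [add_right_comm, ha]; ring⟩

/-- The matrix selects one argument of the maximum: outgoing arrows at white vertices, incoming ones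
at black vertices. -/
theorem mulVec_whiteToBlack_le_tropicalRHS (s : V → ℝ) (v : V) :
    Q.whiteToBlack.mulVec s v ≤ Q.tropicalRHS s v := by
  by_cases h : Q.color v = 0
  · simp only [Matrix.mulVec, dotProduct, whiteToBlack, h, if_true]
    exact le_max_right _ _
  · simp only [Matrix.mulVec, dotProduct, whiteToBlack, h, if_false]
    exact le_max_left _ _

/-! ### Periodicity excludes eigenvalues at least `2` -/

/-- The pairing of the values of `s` on the vertices of color `c` with the weights `w`. -/
def colorPairing (w s : V → ℝ) (c : Fin 2) : ℝ := ∑ v, if Q.color v = c then w v * s v else 0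

/-- By symmetry, `M` moves from `s` to its eigenvector `w`; since `M` joins only opposite colors,
restricting to color `c` on one side leaves color `d` on the other. -/
theorem colorPairing_tropicalRHS_ge {w : V → ℝ} {r : ℝ} (hw : ∀ v, 0 ≤ w v)
    (he : Q.whiteToBlack.mulVec w = r • w) (s : V → ℝ) {c d : Fin 2} (hcd : c ≠ d) :
    r * Q.colorPairing w s d ≤ Q.colorPairing w (Q.tropicalRHS s) c := by
  calc r * Q.colorPairing w s d
      = ∑ u, ∑ v, if Q.color v = c then Q.whiteToBlack v u * w v * s u else 0 := by
        rw [colorPairing, Finset.mul_sum]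
        refine Finset.sum_congr rfl fun u _ => ?_
        by_cases hu : Q.color u = d
        · have hru := congrFun he u
          simp only [Matrix.mulVec, dotProduct, Pi.smul_apply, smul_eq_mul] at hru
          rw [if_pos hu, ← mul_assoc, ← hru, Finset.sum_mul]
          refine Finset.sum_congr rfl fun v _ => ?_
          by_cases hv : Q.color v = c
          · rw [if_pos hv, Q.whiteToBlack_isSymm.apply]
          · rw [if_neg hv, Q.whiteToBlack_eq_zero (by omega), zero_mul, zero_mul]
        · rw [if_neg hu, mul_zero]
          refine (Finset.sum_eq_zero fun v _ => ?_).symm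
          split_ifs with hv
          · rw [Q.whiteToBlack_eq_zero (by omega), zero_mul, zero_mul]
          · rfl
    _ = ∑ v, if Q.color v = c then w v * Q.whiteToBlack.mulVec s v else 0 := by
        rw [Finset.sum_comm]
        refine Finset.sum_congr rfl fun v _ => ?_
        split_ifs with hv
        · rw [Matrix.mulVec, dotProduct, Finset.mul_sum]
          exact Finset.sum_congr rfl fun u _ => by ring
        · simp
    _ ≤ Q.colorPairing w (Q.tropicalRHS s) c := by
        refine Finset.sum_le_sum fun v _ => ?_
        split_ifs with hv
        · exact mul_le_mul_of_nonneg_left (Q.mulVec_whiteToBlack_le_tropicalRHS s v) (hw v)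
        · exact le_rfl

theorem colorPairing_tropicalState_add (w l : V → ℝ) (j : ℤ) (c : Fin 2) :
    Q.colorPairing w (Q.tropicalState l (j + 1)) c + Q.colorPairing w (Q.tropicalState l j) c =
      Q.colorPairing w (Q.tropicalRHS (Q.tropicalState l (j + (c.val : ℤ)))) c := by
  rw [colorPairing, colorPairing, colorPairing, ← Finset.sum_add_distrib]
  refine Finset.sum_congr rfl fun v _ => ?_
  split_ifs with hv
  · rw [← mul_add, Q.tropicalState_add, eps, hv]
  · exact add_zero 0

/-- Periodicity excludes nonnegative eigenvectors with an eigenvalue at least `2`: the pairing of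
such an eigenvector with a suitable tropical `T`-system is strictly increasing. -/
theorem IsTropicallyPeriodic.eigenvector_eq_zero {Q : BipartiteQuiver V}
    (hper : Q.IsTropicallyPeriodic) (w : V → ℝ) (r : ℝ) (hr : 2 ≤ r) (hw : ∀ v, 0 ≤ w v)
    (he : Q.whiteToBlack.mulVec w = r • w) : w = 0 := by
  by_contra hne
  -- If `w` vanished on the black vertices, then `r w = M w` would vanish on the white ones too.
  obtain ⟨b, hb, hwb⟩ : ∃ b, Q.color b = 1 ∧ w b ≠ 0 := by
    by_contra! hblack
    refine hne (funext fun v => ?_)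
    rcases fin_two_cases (Q.color v) with hv | hv
    · have h := congrFun he v
      rw [Matrix.mulVec, dotProduct, Finset.sum_eq_zero fun u _ => ?_] at h
      · rw [Pi.smul_apply, smul_eq_mul, eq_comm, mul_eq_zero] at h
        exact h.resolve_left (by linarith)
      · rcases fin_two_cases (Q.color u) with hu | hu
        · rw [Q.whiteToBlack_eq_zero (hv.trans hu.symm), zero_mul]
        · rw [hblack u hu, mul_zero]
    · exact hblack v hv
  set l : V → ℝ := fun v => if Q.color v = 1 then w v else 0 with hl
  obtain ⟨N, hN, hp⟩ := hper l
  set p : ℤ → ℝ := fun j => Q.colorPairing w (Q.tropicalState l j) 0 with hpdef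
  set q : ℤ → ℝ := fun j => Q.colorPairing w (Q.tropicalState l j) 1 with hqdef
  have hp1 : ∀ j, r * q j ≤ p (j + 1) + p j := fun j => by
    have := Q.colorPairing_tropicalState_add w l j 0
    simp only [Fin.val_zero, Nat.cast_zero, add_zero] at this
    exact (Q.colorPairing_tropicalRHS_ge hw he _ (by decide)).trans_eq this.symm
  have hq1 : ∀ j, r * p (j + 1) ≤ q (j + 1) + q j := fun j => by
    have := Q.colorPairing_tropicalState_add w l j 1
    simp only [Fin.val_one, Nat.cast_one] at this
    exact (Q.colorPairing_tropicalRHS_ge hw he _ (by decide)).trans_eq this.symm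
  have hp0 : p 0 = 0 := by
    simp only [hpdef, Q.tropicalState_zero]
    refine Finset.sum_eq_zero fun v _ => ?_
    split_ifs with hv
    · simp [hl, hv]
    · rfl
  have hq0 : 0 < q 0 := by
    simp only [hqdef, Q.tropicalState_zero]
    refine Finset.sum_pos' (fun v _ => ?_) ⟨b, Finset.mem_univ b, ?_⟩
    · split_ifs with hv
      · simp only [hl, hv, if_true]
        exact mul_self_nonneg _
      · exact le_rfl
    · simp only [hl, hb, if_true]
      exact mul_self_pos.2 hwb
  -- From `p < q` follow `p' ≥ 2 q - p > q` and `q' ≥ 2 p' - q > p'`. Nonnegativity is carried along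
  -- so that `r` can be replaced by `2`.
  have key : ∀ n : ℕ, 0 ≤ p n ∧ p n < q n ∧ q 0 ≤ q n ∧ (0 < n → q 0 < q n) := by
    intro n
    induction n with
    | zero => simp [hp0, hq0]
    | succ n ih =>
      obtain ⟨h1, h2, h3, -⟩ := ih
      have a := hp1 n
      have b := hq1 n
      have a' : 2 * q n ≤ r * q n := mul_le_mul_of_nonneg_right hr (by linarith)
      have hpp : 0 ≤ p ((n : ℤ) + 1) := by linarith
      have b' : 2 * p ((n : ℤ) + 1) ≤ r * p ((n : ℤ) + 1) := mul_le_mul_of_nonneg_right hr hpp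
      push_cast
      exact ⟨hpp, by linarith, by linarith, fun _ => by linarith⟩
  have h1 := (key N).2.2.2 hN
  have h2 : q N = q 0 := by
    have := Q.tropicalState_add_period hp 0
    rw [zero_add] at this
    simp only [hqdef, this]
  linarith

/-! ### Sums over a period -/

/-- The sum of the values of the tropical `T`-system over a period. -/
noncomputable def periodSum (l : V → ℝ) (N : ℕ) (v : V) : ℝ :=
  ∑ j ∈ range N, Q.tropicalState l j v

/-- The shift by `ε_v` in the relations disappears after summation over a period. -/
theorem sum_range_tropicalState_add_eps {l : V → ℝ} {N : ℕ} (h : Q.IsTropicalPeriod l N)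
    (u v : V) : ∑ j ∈ range N, Q.tropicalState l (j + Q.eps v) u = Q.periodSum l N u := by
  rcases fin_two_cases (Q.color v) with hv | hv
  · simp [eps, hv, periodSum]
  · simp only [eps, hv, Fin.val_one, Nat.cast_one]
    exact sum_range_add_of_periodic (g := fun j => Q.tropicalState l j u)
      fun j => congrFun (Q.tropicalState_add_period h j) u

theorem sum_range_sum_mul_tropicalState {l : V → ℝ} {N : ℕ} (h : Q.IsTropicalPeriod l N)
    (v : V) (a : V → ℝ) :
    ∑ j ∈ range N, ∑ u, a u * Q.tropicalState l (j + Q.eps v) u =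
      ∑ u, a u * Q.periodSum l N u := by
  rw [Finset.sum_comm]
  refine Finset.sum_congr rfl fun u _ => ?_
  rw [← Finset.mul_sum, Q.sum_range_tropicalState_add_eps h]

theorem two_mul_periodSum {l : V → ℝ} {N : ℕ} (h : Q.IsTropicalPeriod l N) (v : V) :
    2 * Q.periodSum l N v =
      ∑ j ∈ range N, Q.tropicalRHS (Q.tropicalState l (j + Q.eps v)) v := by
  have h1 := sum_range_add_of_periodic (g := fun j => Q.tropicalState l j v)
      fun j => congrFun (Q.tropicalState_add_period h j) v
  simp only [← Q.tropicalState_add, Finset.sum_add_distrib]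
  rw [h1, two_mul, periodSum]

/-- The period sum `S` satisfies `M S ≤ 2 S`, by summing the bound of the maximum by `M` over time.
-/
theorem periodSum_nonneg (hper : Q.IsTropicallyPeriodic) {l : V → ℝ} {N : ℕ}
    (h : Q.IsTropicalPeriod l N) (v : V) : 0 ≤ Q.periodSum l N v := by
  refine nonneg_of_mulVec_le Q.whiteToBlack_isSymm Q.whiteToBlack_nonneg
    hper.eigenvector_eq_zero (fun v => ?_) v
  rw [Q.two_mul_periodSum h, Matrix.mulVec, dotProduct, ← Q.sum_range_sum_mul_tropicalState h]
  exact Finset.sum_le_sum fun j _ => Q.mulVec_whiteToBlack_le_tropicalRHS _ v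

/-- If a linear form in the neighbors of `v` bounds the right-hand side from below, and does so
strictly at some time, then the sum over a period satisfies the corresponding inequality. -/
theorem sum_mul_periodSum_le {l : V → ℝ} {N : ℕ} (h : Q.IsTropicalPeriod l N) (v : V)
    (a : V → ℝ) (ha : ∀ s, ∑ u, a u * s u ≤ Q.tropicalRHS s v) :
    ∑ u, a u * Q.periodSum l N u ≤ 2 * Q.periodSum l N v := by
  rw [Q.two_mul_periodSum h, ← Q.sum_range_sum_mul_tropicalState h]
  exact Finset.sum_le_sum fun j _ => ha _

/-- The gap between the maximum and the linear form is nonnegative and periodic, so strictness at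
any integer time, even outside the summation window, suffices. -/
theorem sum_mul_periodSum_lt {l : V → ℝ} {N : ℕ} (hN : 0 < N) (h : Q.IsTropicalPeriod l N) (v : V)
    (a : V → ℝ) (ha : ∀ s, ∑ u, a u * s u ≤ Q.tropicalRHS s v) {i : ℤ}
    (hi : ∑ u, a u * Q.tropicalState l (i + Q.eps v) u <
      Q.tropicalRHS (Q.tropicalState l (i + Q.eps v)) v) :
    ∑ u, a u * Q.periodSum l N u < 2 * Q.periodSum l N v := by
  rw [Q.two_mul_periodSum h, ← Q.sum_range_sum_mul_tropicalState h, ← sub_pos,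
    ← Finset.sum_sub_distrib]
  refine sum_range_pos_of_periodic (g := fun j =>
    Q.tropicalRHS (Q.tropicalState l (j + Q.eps v)) v -
      ∑ u, a u * Q.tropicalState l (j + Q.eps v) u) hN (fun j => ?_)
    (fun j => sub_nonneg.2 (ha _)) (sub_pos.2 hi)
  simp only [add_right_comm j (N : ℤ), Q.tropicalState_add_period h]

/-! ### Strictness from the initial values `δ_p` -/

variable [DecidableEq V]

/-- The vertices of the color of `p` change sign in one step if the initial values are `δ_p`. -/
theorem tropicalState_single_add {p u : V} (hu : Q.color u = Q.color p) :
    Q.tropicalState (Pi.single p 1) (1 - Q.eps p) u =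
      -Q.tropicalState (Pi.single p 1) (-Q.eps p) u := by
  have he : Q.eps u = Q.eps p := by rw [eps, eps, hu]
  have h := Q.tropicalState_add (Pi.single p 1) (-Q.eps p) u
  have h0 : Q.tropicalRHS (Pi.single p 1) u = Q.tropicalRHS 0 u :=
    -- All neighbors of `u` have the color opposite to `p`, where `δ_p` vanishes.
    Q.tropicalRHS_congr fun x hx => by
      have hxp : x ≠ p := fun e => Q.color_ne' hx (by rw [e, hu])
      simp [hxp]
  have h1 : Q.tropicalRHS 0 u = 0 := by simp [ClusterQuiver.tropicalRHS]
  rw [he, neg_add_cancel, Q.tropicalState_zero, h0, h1, neg_add_eq_sub] at h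
  linarith

/-- With initial values `δ_p`, every vertex `u` of the color of `p` has the value `-δ_p(u)` at some
time at which the relation for the vertices of the other color is evaluated. -/
theorem exists_tropicalState_single_eq_neg {p v : V} (hv : Q.color p ≠ Q.color v) :
    ∃ i : ℤ, ∀ u, Q.color u = Q.color p →
      Q.tropicalState (Pi.single p 1) (i + Q.eps v) u = -(Pi.single p 1 : V → ℝ) u := by
  have hs := Q.eps_add_eps_of_ne hv
  rcases fin_two_cases (Q.color p) with hp | hp
  · have h0 : Q.eps p = 0 := by simp [eps, hp]
    -- For white `p` the sign changes going forward from state `0` to state `1`, the state that the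
    -- black vertex `v` sees.
    refine ⟨0, fun u hu => ?_⟩
    have := Q.tropicalState_single_add hu
    rw [h0, sub_zero, neg_zero, Q.tropicalState_zero] at this
    rw [show 0 + Q.eps v = 1 by omega, this]
  · have h0 : Q.eps p = 1 := by simp [eps, hp]
    -- For black `p` the sign changes going backward, to state `-1`.
    refine ⟨-1, fun u hu => ?_⟩
    have := Q.tropicalState_single_add hu
    rw [h0, sub_self, Q.tropicalState_zero] at this
    rw [show -1 + Q.eps v = -1 by omega, this, neg_neg]

/-- If some `b p > 0`, then `a p = 0` and `δ_p` itself separates the sums. If `b = 0`, a vertex with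
`a p > 0` works at a time when the values are `-δ_p`: the first sum is `-a p`, the second is `0`. -/
theorem exists_sum_lt_sum {v : V} {a b : V → ℕ} (hab : ∀ u, a u = 0 ∨ b u = 0)
    (hc : ∀ u, 0 < a u → Q.color u ≠ Q.color v) (hne : ∃ u, 0 < a u ∨ 0 < b u) :
    ∃ (p : V) (i : ℤ),
      ∑ u, (a u : ℝ) * Q.tropicalState (Pi.single p 1) (i + Q.eps v) u <
        ∑ u, (b u : ℝ) * Q.tropicalState (Pi.single p 1) (i + Q.eps v) u := by
  by_cases hb : ∃ p, 0 < b p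
  · obtain ⟨p, hp⟩ := hb
    have hap := (hab p).resolve_right hp.ne'
    refine ⟨p, -Q.eps v, ?_⟩
    rw [neg_add_cancel, Q.tropicalState_zero]
    simpa [Pi.single_apply, hap] using hp
  · push Not at hb
    obtain ⟨p, hp⟩ := hne
    have hp : 0 < a p := hp.resolve_right (hb p).not_gt
    obtain ⟨i, hi⟩ := Q.exists_tropicalState_single_eq_neg (hc p hp)
    refine ⟨p, i, ?_⟩
    have h1 : ∀ u, (a u : ℝ) * Q.tropicalState (Pi.single p 1) (i + Q.eps v) u =
        (a u : ℝ) * -(Pi.single p 1 : V → ℝ) u := by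
      intro u
      rcases Nat.eq_zero_or_pos (a u) with h | h
      · simp [h]
      · have h2 := hc u h
        have h3 := hc p hp
        rw [hi u (by omega)]
    have h2 : ∀ u, b u = 0 := fun u => Nat.le_zero.1 (hb u)
    simp only [h1, h2, Nat.cast_zero, zero_mul, Finset.sum_const_zero]
    simpa [Pi.single_apply] using hp

/-! ### The subadditive labeling -/

theorem tropicalSum_eq (N : ℕ) (v : V) :
    Q.tropicalSum N v = ∑ p, Q.periodSum (Pi.single p 1) N v := by
  refine Finset.sum_congr rfl fun p _ => Finset.sum_congr rfl fun j _ => ?_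
  exact Q.tropicalT_of_eq _ v _ j rfl

/-- The weak inequality holds for every `δ_p` and is strict for one of them. The weights `a`, `b`
stand for the two arrow directions in either order, so both inequalities come from one argument. -/
theorem sum_mul_tropicalSum_lt {N : ℕ} (hN : 0 < N)
    (h : ∀ p, Q.IsTropicalPeriod (Pi.single p 1) N) {v : V} {a b : V → ℕ}
    (hab : ∀ u, a u = 0 ∨ b u = 0) (hc : ∀ u, 0 < a u → Q.color u ≠ Q.color v)
    (hne : ∃ u, 0 < a u ∨ 0 < b u)
    (hmax : ∀ s, max (∑ u, (a u : ℝ) * s u) (∑ u, (b u : ℝ) * s u) = Q.tropicalRHS s v) :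
    ∑ u, (a u : ℝ) * Q.tropicalSum N u < 2 * Q.tropicalSum N v := by
  have ha : ∀ s, ∑ u, (a u : ℝ) * s u ≤ Q.tropicalRHS s v := fun s =>
    (le_max_left _ _).trans_eq (hmax s)
  obtain ⟨p, i, hi⟩ := Q.exists_sum_lt_sum hab hc hne
  simp only [tropicalSum_eq, Finset.mul_sum]
  rw [Finset.sum_comm]
  simp only [← Finset.mul_sum]
  rw [Finset.mul_sum]
  exact Finset.sum_lt_sum (fun x _ => Q.sum_mul_periodSum_le (h x) v _ ha)
    ⟨p, Finset.mem_univ p, Q.sum_mul_periodSum_lt hN (h p) v _ ha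
      (hi.trans_le ((le_max_right _ _).trans_eq (hmax _)))⟩

theorem tropicalSum_nonneg (hper : Q.IsTropicallyPeriodic) {N : ℕ}
    (h : ∀ p, Q.IsTropicalPeriod (Pi.single p 1) N) (v : V) : 0 ≤ Q.tropicalSum N v := by
  rw [tropicalSum_eq]
  exact Finset.sum_nonneg fun p _ => Q.periodSum_nonneg hper (h p) v

/-- The inequalities of a strictly subadditive labeling hold for `tropicalSum` at every vertex that
is not isolated. -/
theorem tropicalSum_strict {N : ℕ} (hN : 0 < N)
    (h : ∀ p, Q.IsTropicalPeriod (Pi.single p 1) N) {v : V}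
    (hv : ∃ u, 0 < Q.arrows u v ∨ 0 < Q.arrows v u) :
    ∑ u, (Q.arrows u v : ℝ) * Q.tropicalSum N u < 2 * Q.tropicalSum N v ∧
      ∑ w, (Q.arrows v w : ℝ) * Q.tropicalSum N w < 2 * Q.tropicalSum N v :=
  ⟨Q.sum_mul_tropicalSum_lt hN h (a := fun u => Q.arrows u v) (b := fun u => Q.arrows v u)
      (fun u => Q.no_two_cycle u v) (fun u hu => Q.color_ne u v hu) hv fun _ => rfl,
    Q.sum_mul_tropicalSum_lt hN h (a := fun u => Q.arrows v u) (b := fun u => Q.arrows u v)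
      (fun u => Q.no_two_cycle v u) (fun u hu => (Q.color_ne v u hu).symm)
      (hv.imp fun _ => Or.symm) fun _ => max_comm _ _⟩

theorem tropicalSum_pos (hper : Q.IsTropicallyPeriodic) {N : ℕ} (hN : 0 < N)
    (h : ∀ p, Q.IsTropicalPeriod (Pi.single p 1) N) {v : V}
    (hv : ∃ u, 0 < Q.arrows u v ∨ 0 < Q.arrows v u) : 0 < Q.tropicalSum N v := by
  have h1 := (Q.tropicalSum_strict hN h hv).1
  have h2 : 0 ≤ ∑ u, (Q.arrows u v : ℝ) * Q.tropicalSum N u :=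
    Finset.sum_nonneg fun u _ => mul_nonneg (Nat.cast_nonneg _) (Q.tropicalSum_nonneg hper h u)
  linarith

theorem exists_common_period (hper : Q.IsTropicallyPeriodic) :
    ∃ N : ℕ, 0 < N ∧ ∀ u, Q.IsTropicalPeriod (Pi.single u 1) N := by
  choose n hn hp using fun u : V => hper (Pi.single u 1)
  refine ⟨∏ u, n u, Finset.prod_pos fun u _ => hn u, fun u => ?_⟩
  rw [← Finset.mul_prod_erase univ n (Finset.mem_univ u)]
  exact (hp u).mul _

theorem hasStrictlySubadditiveLabeling (hper : Q.IsTropicallyPeriodic) :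
    Q.HasStrictlySubadditiveLabeling := by
  classical
  obtain ⟨N, hN, h⟩ := Q.exists_common_period hper
  -- At an isolated vertex the values alternate in sign, so `N` is even and `tropicalSum` is `0`
  -- there. Any positive value serves instead, as no neighbor sum involves it.
  set ν : V → ℝ := fun v =>
    if ∃ u, 0 < Q.arrows u v ∨ 0 < Q.arrows v u then Q.tropicalSum N v else 1 with hν
  have hin : ∀ v u, (Q.arrows u v : ℝ) * ν u = (Q.arrows u v : ℝ) * Q.tropicalSum N u := by
    intro v u
    rcases Nat.eq_zero_or_pos (Q.arrows u v) with h0 | h0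
    · simp [h0]
    · simp only [hν]
      rw [if_pos ⟨v, Or.inr h0⟩]
  have hout : ∀ v u, (Q.arrows v u : ℝ) * ν u = (Q.arrows v u : ℝ) * Q.tropicalSum N u := by
    intro v u
    rcases Nat.eq_zero_or_pos (Q.arrows v u) with h0 | h0
    · simp [h0]
    · simp only [hν]
      rw [if_pos ⟨v, Or.inl h0⟩]
  refine ⟨ν, fun v => ?_, fun v => ?_⟩
  · by_cases hv : ∃ u, 0 < Q.arrows u v ∨ 0 < Q.arrows v u
    · simp only [hν]
      rw [if_pos hv]
      exact Q.tropicalSum_pos hper hN h hv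
    · simp only [hν]
      rw [if_neg hv]
      exact one_pos
  · simp only [hin, hout]
    by_cases hv : ∃ u, 0 < Q.arrows u v ∨ 0 < Q.arrows v u
    · simp only [hν]
      rw [if_pos hv]
      exact Q.tropicalSum_strict hN h hv
    · have h1 : ν v = 1 := if_neg hv
      push Not at hv
      have h2 : ∀ u, Q.arrows u v = 0 := fun u => Nat.le_zero.1 (hv u).1
      have h3 : ∀ u, Q.arrows v u = 0 := fun u => Nat.le_zero.1 (hv u).2
      simp [h1, h2, h3]

end

end BipartiteQuiver

theorem mainTheorem7 {V : Type*} [Fintype V] [DecidableEq V] (Q : BipartiteQuiver V)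
    (hrec : Q.IsRecurrent) (hper : Q.IsTropicallyPeriodic) :
    Q.HasStrictlySubadditiveLabeling ∧
      (∃ N : ℕ, 0 < N ∧ ∀ u, Q.IsTropicalPeriod (Pi.single u 1) N) ∧
      ((∀ v, ∃ u, 0 < Q.arrows u v ∨ 0 < Q.arrows v u) →
        ∀ N : ℕ, 0 < N → (∀ u, Q.IsTropicalPeriod (Pi.single u 1) N) →
          Q.IsStrictlySubadditiveLabeling (Q.tropicalSum N)) :=
  ⟨Q.hasStrictlySubadditiveLabeling hper, Q.exists_common_period hper, fun hv _ hN h =>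
    ⟨fun v => Q.tropicalSum_pos hper hN h (hv v), fun v => Q.tropicalSum_strict hN h (hv v)⟩⟩
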